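/- **Theorem (Formal Wirthmüller isomorphism).** *Conventions.* Let $\mathcal C$ and $\mathcal D$ be triangulated categories with closed symmetric monoidal structures, with unit objects $S\in\mathcal C$ and $T\in\mathcal D$. In each of them the tensor product is compatible with the triangulation in the following sense: there are isomorphisms $\Sigma X\otimes W\cong\Sigma(X\otimes W)$, natural in $X$ and $W$ and compatible with the unit isomorphism $X\otimes\mathbf 1\cong X$, which make every functor $(-)\otimes W$ exact. Let $f^*\colon\mathcal D\to\mathcal C$ be a strong symmetric monoidal exact functor whose isomorphisms $f^*\Sigma Y\cong\Sigma f^*Y$ and $f^*Y\otimes f^*Z\cong f^*(Y\otimes Z)$ are compatible, i.e. the two resulting isomorphisms $f^*\Sigma Y\otimes f^*Z\cong\Sigma f^*(Y\otimes Z)$ agree. Assume that $f^*$ has a right adjoint $f_*$ and a left adjoint $f_!$. (It is not assumed that $f^*$ preserves internal homs.) Let $\zeta,\sigma$ be the unit and counit of $(f_!,f^*)$, and $\varepsilon$ the counit of $(f^*,f_*)$. For $Y\in\mathcal D$ and $X\in\mathcal C$ let $$\bar\pi\colon f_!(f^*Y\otimes X)\longrightarrow f_!f^*Y\otimes f_!X\xrightarrow{\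 \sigma\otimes\mathrm{id}\ }Y\otimes f_!X,$$ where $f_!(W\otimes X)\to f_!W\otimes f_!X$ is the adjoint of $W\otimes X\xrightarrow{\zeta\otimes\zeta}f^*f_!W\otimes f^*f_!X\cong f^*(f_!W\otimes f_!X)$. We say that $\bar\pi$ is an isomorphism for $X$ if it is an isomorphism for that $X$ and every $Y\in\mathcal D$. Given an object $C\in\mathcal C$ and an isomorphism $\theta\colon f_*S\cong f_!C$, let $\tau\colon T\to f_*S\cong f_!C$ be the composite of the adjoint of $f^*T\cong S$ with $\theta$. If $\bar\pi$ is an isomorphism for $C$, let $\omega$ be the composite $$\omega\colon f_*X\cong f_*X\otimes T\xrightarrow{\mathrm{id}\otimes\tau}f_*X\otimes f_!C\xrightarrow{\bar\pi^{-1}}f_!(f^*f_*X\otimes C)\xrightarrow{f_!(\varepsilon\otimes\mathrm{id})}f_!(X\otimes C).$$ An object $X$ of an additive category $\mathcal A$ is compact if $\mathcal A(X,-)$ converts coproducts to direct sums. $\mathcal A$ is compactly generated with generating set $\mathcal G$ if it has arbitrary coproducts and $\mathcal G$ is a set of compact objects such that a map $g$ is an isomorphism whenever $\mathcal A(X,g)$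 is an isomorphism for all $X\in\mathcal G$. An object $X$ of a closed symmetric monoidal category with unit $\mathbf 1$ is dualizable if the canonical map $\nu\colon \mathrm{Hom}(X,\mathbf 1)\otimes X\to\mathrm{Hom}(X,X)$ is an isomorphism. *Statement.* Let $\mathcal C$ be compactly generated with generating set $\mathcal G$, let its unit object $S$ be compact, and suppose that $\bar\pi$ is an isomorphism for all $X\in\mathcal G$. Then $\bar\pi$ is an isomorphism for all $X\in\mathcal C$; in particular $\omega$ is defined for every choice of $C$ and $\theta$. Fix such a choice and suppose that $\omega$ is an isomorphism for all $X\in\mathcal G$. 1. If the objects of $\mathcal G$ are dualizable, then $\omega$ is an isomorphism for all dualizable $X\in\mathcal C$. 2. If $\mathcal D$ is compactly generated with some generating set $\mathcal H$ such that $f^*Y$ is compact for all $Y\in\mathcal H$, then $\omega$ is an isomorphism for all $X\in\mathcal C$. -/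

import Mathlib

open CategoryTheory CategoryTheory.Limits MonoidalCategory Opposite

universe v u u₁ u₂

namespace Wirthmuller

section Additive

variable {A : Type u} [Category.{v} A] [Preadditive A]

/-- An object `X` of an additive category is compact if the functor `A(X, -)`, with values in
abelian groups, converts set-indexed coproducts to direct sums. -/
def IsCompactObject (X : A) : Prop :=
  ∀ I : Type v, PreservesColimitsOfShape (Discrete I) (preadditiveCoyoneda.obj (op X))

/-- `A` is compactly generated with generating set `G`: it has arbitrary coproducts, and `G` is a
(small) set of compact objects that detects isomorphisms. -/
structure IsCompactlyGeneratedBy (G : Set A) : Prop where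
  hasCoproducts : HasCoproducts.{v} A
  small : Small.{v} G
  compact : ∀ X ∈ G, IsCompactObject X
  detects : ∀ ⦃Y Z : A⦄ (f : Y ⟶ Z),
    (∀ X ∈ G, Function.Bijective fun g : X ⟶ Y => g ≫ f) → IsIso f

end Additive

section Closed

variable {A : Type u} [Category.{v} A] [MonoidalCategory A] [SymmetricCategory A]
  [MonoidalClosed A]

/-- The dual `D X = Hom(X, 𝟙)`. -/
abbrev dual (X : A) : A := (ihom X).obj (𝟙_ A)

/-- The natural map `ν : D X ⊗ W ⟶ Hom(X, W)`, adjoint to the evaluation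
`X ⊗ D X ⊗ W ⟶ 𝟙 ⊗ W ≅ W`. -/
noncomputable def nu (X W : A) : dual X ⊗ W ⟶ (ihom X).obj W :=
  MonoidalClosed.curry
    ((α_ X (dual X) W).inv ≫ ((ihom.ev X).app (𝟙_ A) ▷ W) ≫ (λ_ W).hom)

/-- `X` is dualizable if `ν : D X ⊗ X ⟶ Hom(X, X)` is an isomorphism. -/
def IsDualizable (X : A) : Prop := IsIso (nu X X)

end Closed

section Triangulated

variable (A : Type u) [Category.{v} A] [Preadditive A] [HasZeroObject A] [HasShift A ℤ]
  [∀ n : ℤ, (shiftFunctor A n).Additive] [Pretriangulated A] [MonoidalCategory A]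

/-- Compatibility of a tensor product with a triangulation: isomorphisms
`ΣX ⊗ W ≅ Σ(X ⊗ W)`, natural in both variables (naturality in `X` is part of `CommShift`) and
compatible with the unit isomorphism, which make each functor `(-) ⊗ W` exact. -/
class TensorTriangulated where
  commShift (W : A) : (tensorRight W).CommShift ℤ
  isTriangulated (W : A) : (tensorRight W).IsTriangulated
  natural {W W' : A} (g : W ⟶ W') (X : A) :
    (X⟦(1 : ℤ)⟧ ◁ g) ≫ ((tensorRight W').commShiftIso (1 : ℤ)).hom.app X =
      ((tensorRight W).commShiftIso (1 : ℤ)).hom.app X ≫ (X ◁ g)⟦(1 : ℤ)⟧'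
  unit (X : A) :
    ((tensorRight (𝟙_ A)).commShiftIso (1 : ℤ)).hom.app X ≫ ((ρ_ X).hom)⟦(1 : ℤ)⟧' =
      (ρ_ (X⟦(1 : ℤ)⟧)).hom

variable {A} in
/-- The isomorphism `ΣX ⊗ W ≅ Σ(X ⊗ W)`. -/
def tensorShift [TensorTriangulated A] (X W : A) : X⟦(1 : ℤ)⟧ ⊗ W ≅ (X ⊗ W)⟦(1 : ℤ)⟧ :=
  letI := TensorTriangulated.commShift W
  ((tensorRight W).commShiftIso (1 : ℤ)).app X

end Triangulated

variable {C : Type u₁} [Category.{v} C] [MonoidalCategory C]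
  {D : Type u₂} [Category.{v} D] [MonoidalCategory D]

/-- The isomorphisms `F(ΣY) ≅ Σ(F Y)` of an exact strong monoidal functor are compatible with
`ΣY ⊗ Z ≅ Σ(Y ⊗ Z)`: the two ways to identify `F(ΣY) ⊗ F Z` with `Σ F(Y ⊗ Z)` agree. -/
def ShiftMonoidalCompatible
    [Preadditive C] [HasZeroObject C] [HasShift C ℤ] [∀ n : ℤ, (shiftFunctor C n).Additive]
    [Pretriangulated C] [TensorTriangulated C]
    [Preadditive D] [HasZeroObject D] [HasShift D ℤ] [∀ n : ℤ, (shiftFunctor D n).Additive]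
    [Pretriangulated D] [TensorTriangulated D]
    (F : D ⥤ C) [F.Monoidal] [F.CommShift ℤ] : Prop :=
  ∀ Y Z : D,
    Functor.LaxMonoidal.μ F (Y⟦(1 : ℤ)⟧) Z ≫ F.map (tensorShift Y Z).hom ≫
        (F.commShiftIso (1 : ℤ)).hom.app (Y ⊗ Z) =
      ((F.commShiftIso (1 : ℤ)).hom.app Y ▷ F.obj Z) ≫
        (tensorShift (F.obj Y) (F.obj Z)).hom ≫ (Functor.LaxMonoidal.μ F Y Z)⟦(1 : ℤ)⟧'

/- In the names below, `fs`, `fr`, `fl` are `f^*`, `f_*` and `f_!`. -/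
variable {fs : D ⥤ C} [fs.Monoidal] {fr fl : C ⥤ D}

/-- The op-lax structure map `f_!(W ⊗ X) ⟶ f_! W ⊗ f_! X`, adjoint to
`W ⊗ X ⟶ f^* f_! W ⊗ f^* f_! X ≅ f^*(f_! W ⊗ f_! X)`. -/
def oplaxMap (adjl : fl ⊣ fs) (W X : C) : fl.obj (W ⊗ X) ⟶ fl.obj W ⊗ fl.obj X :=
  (adjl.homEquiv _ _).symm
    ((adjl.unit.app W ⊗ₘ adjl.unit.app X) ≫ Functor.LaxMonoidal.μ fs (fl.obj W) (fl.obj X))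

/-- The map `π̄ : f_!(f^* Y ⊗ X) ⟶ f_! f^* Y ⊗ f_! X ⟶ Y ⊗ f_! X`. -/
def piBar (adjl : fl ⊣ fs) (Y : D) (X : C) : fl.obj (fs.obj Y ⊗ X) ⟶ Y ⊗ fl.obj X :=
  oplaxMap adjl (fs.obj Y) X ≫ (adjl.counit.app Y ▷ fl.obj X)

/-- The map `τ : T ⟶ f_* S ≅ f_! K`, where `T ⟶ f_* S` is adjoint to `f^* T ≅ S`. -/
def tauUnit (adjr : fs ⊣ fr) {K : C} (θ : fr.obj (𝟙_ C) ≅ fl.obj K) : 𝟙_ D ⟶ fl.obj K :=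
  adjr.homEquiv _ _ (Functor.OplaxMonoidal.η fs) ≫ θ.hom

/-- The map `τ : Y ≅ Y ⊗ T ⟶ Y ⊗ f_! K ≅ f_!(f^* Y ⊗ K)`, the last isomorphism being the inverse
of `π̄`. -/
noncomputable def tau (adjl : fl ⊣ fs) (adjr : fs ⊣ fr) {K : C}
    (θ : fr.obj (𝟙_ C) ≅ fl.obj K) (h : ∀ Y : D, IsIso (piBar adjl Y K)) (Y : D) :
    Y ⟶ fl.obj (fs.obj Y ⊗ K) :=
  haveI := h Y
  (ρ_ Y).inv ≫ (Y ◁ tauUnit adjr θ) ≫ inv (piBar adjl Y K)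

/-- The comparison map `ω : f_* X ⟶ f_!(f^* f_* X ⊗ K) ⟶ f_!(X ⊗ K)`. -/
noncomputable def omega (adjl : fl ⊣ fs) (adjr : fs ⊣ fr) {K : C}
    (θ : fr.obj (𝟙_ C) ≅ fl.obj K) (h : ∀ Y : D, IsIso (piBar adjl Y K)) (X : C) :
    fr.obj X ⟶ fl.obj (X ⊗ K) :=
  tau adjl adjr θ h (fr.obj X) ≫ fl.map (adjr.counit.app X ▷ K)

end Wirthmuller

namespace Wirthmuller

/-! For fixed `Y`, both sides of `π̄` are left adjoints in `X`, because the tensor products are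
closed. Passing to conjugates turns invertibility of `π̄` on generators into invertibility of a map
of right adjoints tested by those generators; this extends `π̄` to all objects
(`isIso_app_of_detects`).

For `ω` the aim is that the objects where it is invertible form a triangulated subcategory. Source
and target are exact functors, but `ω` is not shown to commute with their shift isomorphisms.
Instead `projectionMap_omega` identifies `ω` at `f^*Y ⊗ X` with `Y ⊗ ω` whenever tensoring with `Y`
and with `f^*Y` are equivalences. For `Y = ΣT` this makes invertibility of `ω` stable under
suspension (`omegaIso_shift_iff`), and a five lemma using only naturality (`isIso_app_obj₃`) handles
cones.

Part 1: since `S` is compact, dualizable objects are compact, and compact objects are retracts of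
objects built from the generators by finitary triangulated operations
(`IsCompactlyGeneratedBy.exists_retract`). Part 2: if `f^*` sends the generators of the target to
compact objects, invertibility of `ω` also passes to coproducts (`isIso_app_coproduct`), and the
localizing subcategory generated by `G` is everything (`IsCompactlyGeneratedBy.induction`). -/

/-- The image of a coproduct cofan under a functor preserving it. -/
lemma exists_isColimit_map {A : Type u₁} [Category.{v} A] {B : Type u₂} [Category.{v} B] (L : A ⥤ B) {I : Type v}
    [PreservesColimitsOfShape (Discrete I) L] {M : I → A} {c : Cofan M} (hc : IsColimit c) :
    Nonempty (IsColimit (Cofan.mk (L.obj c.pt) fun i => L.map (c.inj i))) :=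
  ⟨isColimitCofanMkObjOfIsColimit L M c.inj
    (IsColimit.ofIsoColimit hc (Cofan.ext (Iso.refl _) (by simp)))⟩

/-! ### Compactness as finite factorization of maps into coproducts -/

section Compact

variable {A : Type u} [Category.{v} A] [Preadditive A]

open Classical in
/-- The projection of a coproduct onto one of its summands. -/
noncomputable def cofanProj {I : Type v} {M : I → A} {c : Cofan M} (hc : IsColimit c) (i : I) :
    c.pt ⟶ M i :=
  Cofan.IsColimit.desc hc fun j => if h : j = i then eqToHom (by rw [h]) else 0

lemma inj_cofanProj {I : Type v} {M : I → A} {c : Cofan M} (hc : IsColimit c) (i : I) :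
    c.inj i ≫ cofanProj hc i = 𝟙 _ := by
  simp [cofanProj]

lemma inj_cofanProj_of_ne {I : Type v} {M : I → A} {c : Cofan M} (hc : IsColimit c) {i j : I}
    (h : j ≠ i) : c.inj j ≫ cofanProj hc i = 0 := by
  simp [cofanProj, h]

lemma sum_comp_cofanProj {I : Type v} {M : I → A} {c : Cofan M} (hc : IsColimit c) {X : A}
    (F : Finset I) (x : ∀ i, X ⟶ M i) {i : I} (hi : i ∈ F) :
    (∑ j ∈ F, x j ≫ c.inj j) ≫ cofanProj hc i = x i := by
  rw [Preadditive.sum_comp, Finset.sum_eq_single i]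
  · simp [inj_cofanProj]
  · intro j _ hj
    simp [inj_cofanProj_of_ne hc hj]
  · exact fun h => (h hi).elim

/-- Every map from `X` to a coproduct is a finite sum of maps into the summands. -/
def FactorsFinitely (X : A) : Prop :=
  ∀ (I : Type v) (M : I → A) (c : Cofan M), IsColimit c → ∀ f : X ⟶ c.pt,
    ∃ (F : Finset I) (x : ∀ i, X ⟶ M i), f = ∑ i ∈ F, x i ≫ c.inj i

open Classical in
lemma exists_sum_add {I : Type v} {M : I → A} {c : Cofan M} {X : A} {f g : X ⟶ c.pt}
    (hf : ∃ (F : Finset I) (x : ∀ i, X ⟶ M i), f = ∑ i ∈ F, x i ≫ c.inj i)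
    (hg : ∃ (F : Finset I) (x : ∀ i, X ⟶ M i), g = ∑ i ∈ F, x i ≫ c.inj i) :
    ∃ (F : Finset I) (x : ∀ i, X ⟶ M i), f + g = ∑ i ∈ F, x i ≫ c.inj i := by
  obtain ⟨F, x, rfl⟩ := hf
  obtain ⟨F', x', rfl⟩ := hg
  refine ⟨F ∪ F', fun i => (if i ∈ F then x i else 0) + (if i ∈ F' then x' i else 0), ?_⟩
  simp only [Preadditive.add_comp, Finset.sum_add_distrib, ite_comp, zero_comp]
  rw [Finset.sum_ite_mem, Finset.sum_ite_mem, Finset.union_inter_cancel_left,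
    Finset.union_inter_cancel_right]

/-- The quotient of `A(X, ∐ M)` by the subgroup of finite sums kills each summand, so the quotient
map vanishes by the universal property of the direct sum in abelian groups. -/
lemma IsCompactObject.factorsFinitely {X : A} (hX : IsCompactObject X) : FactorsFinitely X := by
  intro I M c hc f
  have := hX I
  let Φ := preadditiveCoyoneda.obj (op X)
  let hΦ := isColimitOfPreserves Φ hc
  let H : AddSubgroup (X ⟶ c.pt) :=
    { carrier := {f | ∃ (F : Finset I) (x : ∀ i, X ⟶ M i), f = ∑ i ∈ F, x i ≫ c.inj i}
      add_mem' := exists_sum_add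
      zero_mem' := ⟨∅, fun _ => 0, by simp⟩
      neg_mem' := by
        rintro _ ⟨F, x, rfl⟩
        exact ⟨F, fun i => -x i, by simp⟩ }
  let q : Φ.obj c.pt ⟶ AddCommGrpCat.of ((X ⟶ c.pt) ⧸ H) :=
    AddCommGrpCat.ofHom (QuotientAddGroup.mk' H)
  have hq : q = 0 := by
    refine hΦ.hom_ext fun ⟨i⟩ => ?_
    ext (x : X ⟶ M i)
    have : x ≫ c.inj i ∈ H :=
      ⟨{i}, open Classical in fun j => if h : j = i then x ≫ eqToHom (by rw [h]) else 0, by simp⟩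
    exact (QuotientAddGroup.eq_zero_iff (N := H) _).2 this
  have : q f = 0 := by rw [hq]; rfl
  exact (QuotientAddGroup.eq_zero_iff (N := H) f).1 this

lemma FactorsFinitely.eq_zero {X : A} (hX : FactorsFinitely X) {I : Type v} {M : I → A}
    {c : Cofan M} (hc : IsColimit c) {f : X ⟶ c.pt} (h : ∀ i, f ≫ cofanProj hc i = 0) :
    f = 0 := by
  obtain ⟨F, x, rfl⟩ := hX I M c hc f
  refine Finset.sum_eq_zero fun i hi => ?_
  rw [← sum_comp_cofanProj hc F x hi, h i, zero_comp]

/-- Left adjoints of coproduct preserving functors preserve `FactorsFinitely`. -/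
lemma FactorsFinitely.obj_leftAdjoint {B : Type u₂} [Category.{v} B] [Preadditive B]
    {L : A ⥤ B} {R : B ⥤ A} [R.Additive] (adj : L ⊣ R)
    (hR : ∀ I : Type v, PreservesColimitsOfShape (Discrete I) R) {X : A}
    (hX : FactorsFinitely X) : FactorsFinitely (L.obj X) := by
  intro I M c hc f
  have := hR I
  obtain ⟨hc'⟩ := exists_isColimit_map R hc
  obtain ⟨F, x, hx⟩ := hX I _ _ hc' (adj.homEquiv _ _ f)
  have := adj.left_adjoint_additive
  refine ⟨F, fun i => (adj.homEquiv _ _).symm (x i), ?_⟩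
  apply (adj.homEquiv _ _).injective
  rw [hx]
  simp [Adjunction.homEquiv_unit, Adjunction.homEquiv_counit, Functor.map_sum,
    Preadditive.comp_sum]

end Compact

/-! ### Compactness under shifts and extensions -/

section CompactTriangulated

variable {A : Type u} [Category.{v} A] [Preadditive A] [HasShift A ℤ]
  [∀ n : ℤ, (shiftFunctor A n).Additive]

lemma FactorsFinitely.shift {X : A} (hX : FactorsFinitely X) (n : ℤ) :
    FactorsFinitely (X⟦n⟧) :=
  have : (shiftEquiv A n).inverse.Additive := inferInstanceAs (shiftFunctor A (-n)).Additive
  hX.obj_leftAdjoint (shiftEquiv A n).toAdjunction fun _ =>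
    inferInstanceAs (PreservesColimitsOfShape _ (shiftEquiv A n).inverse)

lemma FactorsFinitely.ext₂ [HasZeroObject A] [Pretriangulated A]
    {T : Pretriangulated.Triangle A}
    (hT : T ∈ Pretriangulated.distinguishedTriangles) (h₁ : FactorsFinitely T.obj₁)
    (h₃ : FactorsFinitely T.obj₃) : FactorsFinitely T.obj₂ := by
  intro I M c hc f
  obtain ⟨F, x, hx⟩ := h₁ I M c hc (T.mor₁ ≫ f)
  -- The components of `f` indexed by `F` restrict along `T.mor₁` to the coefficients `x`, so the
  -- difference vanishes on `T.obj₁` and factors through `T.obj₃`.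
  obtain ⟨g, hg⟩ := T.yoneda_exact₂ hT (f - ∑ i ∈ F, (f ≫ cofanProj hc i) ≫ c.inj i) (by
    rw [Preadditive.comp_sub, hx, Preadditive.comp_sum, sub_eq_zero]
    refine Finset.sum_congr rfl fun i hi => ?_
    rw [← Category.assoc, ← Category.assoc, hx, sum_comp_cofanProj hc F x hi])
  obtain ⟨F', z, hz⟩ := h₃ I M c hc g
  rw [sub_eq_iff_eq_add] at hg
  rw [hg]
  refine exists_sum_add ⟨F', fun i => T.mor₂ ≫ z i, ?_⟩ ⟨F, _, rfl⟩
  rw [hz, Preadditive.comp_sum]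
  simp

end CompactTriangulated

/-! ### The telescope of a sequence -/

section Telescope

variable {A : Type u} [Category.{v} A] [Preadditive A] {Y : ℕ → A} (j : ∀ n, Y n ⟶ Y (n + 1))
  {c : Cofan fun n : ULift.{v} ℕ => Y n.down} (hc : IsColimit c)

/-- The map `1 - shift` on the coproduct of a sequence, whose cone is the telescope. -/
noncomputable def oneSubShift : c.pt ⟶ c.pt :=
  𝟙 _ - Cofan.IsColimit.desc hc fun n => j n.down ≫ c.inj ⟨n.down + 1⟩

lemma inj_oneSubShift (n : ℕ) :
    c.inj ⟨n⟩ ≫ oneSubShift j hc = c.inj ⟨n⟩ - j n ≫ c.inj ⟨n + 1⟩ := by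
  simp [oneSubShift]

lemma oneSubShift_proj_zero :
    oneSubShift j hc ≫ cofanProj hc ⟨0⟩ = cofanProj hc ⟨0⟩ := by
  refine Cofan.IsColimit.hom_ext hc _ _ fun ⟨n⟩ => ?_
  rw [← Category.assoc, inj_oneSubShift, Preadditive.sub_comp, Category.assoc,
    inj_cofanProj_of_ne hc (j := ⟨n + 1⟩) (by simp), comp_zero, sub_zero]

lemma oneSubShift_proj_succ (k : ℕ) :
    oneSubShift j hc ≫ cofanProj hc ⟨k + 1⟩ =
      cofanProj hc ⟨k + 1⟩ - cofanProj hc ⟨k⟩ ≫ j k := by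
  refine Cofan.IsColimit.hom_ext hc _ _ fun ⟨n⟩ => ?_
  rw [← Category.assoc, inj_oneSubShift, Preadditive.sub_comp, Preadditive.comp_sub,
    Category.assoc, ← Category.assoc _ _ (j k)]
  congr 1
  by_cases h : n = k
  · subst h
    simp [inj_cofanProj]
  · rw [inj_cofanProj_of_ne hc (by simpa using h), inj_cofanProj_of_ne hc (by simpa using h)]
    simp

/-- The components of `b` satisfy `b₀ = 0` and `bₖ₊₁ = bₖ ≫ jₖ`, so all vanish; finite factorization
then makes `b` itself zero. -/
lemma FactorsFinitely.eq_zero_of_comp_oneSubShift {X : A} (hX : FactorsFinitely X)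
    (b : X ⟶ c.pt) (hb : b ≫ oneSubShift j hc = 0) : b = 0 := by
  refine hX.eq_zero hc fun ⟨k⟩ => ?_
  induction k with
  | zero => rw [← oneSubShift_proj_zero j hc, ← Category.assoc, hb, zero_comp]
  | succ k ih =>
    have := hb =≫ cofanProj hc ⟨k + 1⟩
    rw [Category.assoc, oneSubShift_proj_succ, Preadditive.comp_sub, ← Category.assoc _ _ (j k),
      ih, zero_comp, sub_zero, zero_comp] at this
    exact this

omit [Preadditive A] in
variable {j} in
lemma exists_factor_of_le {H : A} {κ : ∀ n, Y n ⟶ H} (hκ : ∀ n, j n ≫ κ (n + 1) = κ n)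
    {X : A} {n m : ℕ} (h : n ≤ m) (x : X ⟶ Y n) : ∃ x' : X ⟶ Y m, x' ≫ κ m = x ≫ κ n := by
  induction m, h using Nat.le_induction with
  | base => exact ⟨x, rfl⟩
  | succ m _ ih =>
    obtain ⟨x', hx'⟩ := ih
    exact ⟨x' ≫ j m, by rw [Category.assoc, hκ, hx']⟩

variable {j} in
lemma exists_factor_sum {H : A} {κ : ∀ n, Y n ⟶ H} (hκ : ∀ n, j n ≫ κ (n + 1) = κ n)
    {X : A} (F : Finset (ULift.{v} ℕ)) (x : ∀ n : ULift.{v} ℕ, X ⟶ Y n.down) :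
    ∃ (N : ℕ) (x' : X ⟶ Y N), x' ≫ κ N = ∑ n ∈ F, x n ≫ κ n.down := by
  classical
  induction F using Finset.induction_on with
  | empty => exact ⟨0, 0, by simp⟩
  | insert n F hn ih =>
    obtain ⟨N, x', hx'⟩ := ih
    obtain ⟨y, hy⟩ := exists_factor_of_le hκ (le_max_left N n.down) x'
    obtain ⟨z, hz⟩ := exists_factor_of_le hκ (le_max_right N n.down) (x n)
    exact ⟨_, z + y, by rw [Finset.sum_insert hn, Preadditive.add_comp, hy, hz, hx']⟩

end Telescope

/-! ### Covers by coproducts of generators -/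

section Cover

variable {A : Type u} [Category.{v} A] [Preadditive A] {G : Set A} {P : ObjectProperty A}

lemma eq_zero_of_comp_shift [HasShift A ℤ]
    [∀ n : ℤ, (shiftFunctor A n).Additive] {X B B' : A} {φ : B ⟶ B'}
    (hφ : ∀ b : X⟦(-1 : ℤ)⟧ ⟶ B, b ≫ φ = 0 → b = 0) (f : X ⟶ B⟦(1 : ℤ)⟧)
    (hf : f ≫ φ⟦(1 : ℤ)⟧' = 0) : f = 0 := by
  let e := shiftFunctorCompIsoId A (1 : ℤ) (-1) (by simp)
  have h := hφ (f⟦(-1 : ℤ)⟧' ≫ e.hom.app B) (by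
    have hn := e.hom.naturality φ
    dsimp at hn
    rw [Category.assoc, ← hn, ← Category.assoc, ← Functor.map_comp, hf, Functor.map_zero,
      zero_comp])
  rw [← (shiftFunctor A (-1 : ℤ)).map_eq_zero_iff]
  rwa [← cancel_mono (e.hom.app B), zero_comp]

lemma exists_cover (hG : IsCompactlyGeneratedBy G) (hPG : ∀ X ∈ G, P X)
    (hP : ∀ (I : Type v) (M : I → A) (c : Cofan M), IsColimit c → (∀ i, P (M i)) → P c.pt)
    (F : A) : ∃ (W : A) (e : W ⟶ F), P W ∧ ∀ t ∈ G, ∀ f : t ⟶ F, ∃ f', f' ≫ e = f := by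
  have := hG.small
  have := hG.hasCoproducts
  let I := Σ g : Shrink.{v} G, (((equivShrink G).symm g).1 ⟶ F)
  let M : I → A := fun i => ((equivShrink G).symm i.1).1
  refine ⟨∐ M, Sigma.desc fun i => i.2, ?_, fun t ht f => ?_⟩
  · exact hP I M (Cofan.mk _ (Sigma.ι M)) (coproductIsCoproduct M) fun i =>
      hPG _ ((equivShrink G).symm i.1).2
  · have ht' : ((equivShrink G).symm (equivShrink G ⟨t, ht⟩)).1 = t := by simp
    refine ⟨eqToHom ht'.symm ≫ Sigma.ι M ⟨equivShrink G ⟨t, ht⟩, eqToHom ht' ≫ f⟩, ?_⟩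
    simp

end Cover

/-! ### Compact generators generate as a localizing subcategory -/

section Localizing

open Pretriangulated

variable {A : Type u} [Category.{v} A] [Preadditive A] [HasZeroObject A] [HasShift A ℤ]
  [∀ n : ℤ, (shiftFunctor A n).Additive] [Pretriangulated A]

variable {G : Set A} {P : ObjectProperty A}

/-- Cover the fibre of `q` by a coproduct of generators and take the cone of the resulting map to
`Y`. A map from a generator killed by `q` lifts to the fibre, then to the cover, and so dies in the
cone. -/
lemma exists_kill (hG : IsCompactlyGeneratedBy G) (hPG : ∀ X ∈ G, P X)
    (hP : ∀ (I : Type v) (M : I → A) (c : Cofan M), IsColimit c → (∀ i, P (M i)) → P c.pt)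
    (hP' : ∀ T ∈ distTriang A, P T.obj₁ → P T.obj₂ → P T.obj₃)
    {X Y : A} (hY : P Y) (q : Y ⟶ X) :
    ∃ (Y' : A) (q' : Y' ⟶ X) (j : Y ⟶ Y'), P Y' ∧ j ≫ q' = q ∧
      ∀ t ∈ G, ∀ a : t ⟶ Y, a ≫ q = 0 → a ≫ j = 0 := by
  obtain ⟨F, i, δ, hF⟩ := distinguished_cocone_triangle₁ q
  obtain ⟨W, e, hW, he⟩ := exists_cover hG hPG hP F
  obtain ⟨Y', j, δ', hY'⟩ := distinguished_cocone_triangle (e ≫ i)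
  have hiq : i ≫ q = 0 := comp_distTriang_mor_zero₁₂ _ hF
  have hej : (e ≫ i) ≫ j = 0 := comp_distTriang_mor_zero₁₂ _ hY'
  obtain ⟨q', hq'⟩ := Triangle.yoneda_exact₂ _ hY' q (by
    change (e ≫ i) ≫ q = 0
    rw [Category.assoc, hiq, comp_zero])
  refine ⟨Y', q', j, hP' _ hY' hW hY, hq'.symm, fun t ht a ha => ?_⟩
  obtain ⟨a', rfl⟩ : ∃ a' : t ⟶ F, a = a' ≫ i := Triangle.coyoneda_exact₂ _ hF a ha
  obtain ⟨a'', rfl⟩ := he t ht a'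
  rw [Category.assoc, Category.assoc, ← Category.assoc e, hej, comp_zero]

lemma exists_tower (hG : IsCompactlyGeneratedBy G) (hPG : ∀ X ∈ G, P X)
    (hP : ∀ (I : Type v) (M : I → A) (c : Cofan M), IsColimit c → (∀ i, P (M i)) → P c.pt)
    (hP' : ∀ T ∈ distTriang A, P T.obj₁ → P T.obj₂ → P T.obj₃) (X : A) :
    ∃ (Y : ℕ → A) (q : ∀ n, Y n ⟶ X) (j : ∀ n, Y n ⟶ Y (n + 1)), (∀ n, P (Y n)) ∧
      (∀ n, j n ≫ q (n + 1) = q n) ∧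
      (∀ n, ∀ t ∈ G, ∀ a : t ⟶ Y n, a ≫ q n = 0 → a ≫ j n = 0) ∧
      ∀ t ∈ G, ∀ f : t ⟶ X, ∃ f', f' ≫ q 0 = f := by
  obtain ⟨W, e, hW, he⟩ := exists_cover hG hPG hP X
  choose N r k hN hk hz using fun (Z : { Z : Over X // P Z.left }) =>
    exists_kill hG hPG hP hP' Z.2 Z.1.hom
  let s : ℕ → { Z : Over X // P Z.left } := fun n =>
    Nat.rec ⟨Over.mk e, hW⟩ (fun _ Z => ⟨Over.mk (r Z), hN Z⟩) n
  exact ⟨fun n => (s n).1.left, fun n => (s n).1.hom, fun n => k (s n), fun n => (s n).2,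
    fun n => hk (s n), fun n => hz (s n), he⟩

/-- The localizing subcategory generated by a set of compact generators is everything. -/
theorem IsCompactlyGeneratedBy.induction (hG : IsCompactlyGeneratedBy G) (hPG : ∀ X ∈ G, P X)
    (hP : ∀ (I : Type v) (M : I → A) (c : Cofan M), IsColimit c → (∀ i, P (M i)) → P c.pt)
    (hP' : ∀ T ∈ distTriang A, P T.obj₁ → P T.obj₂ → P T.obj₃)
    (hiso : ∀ {X Y : A}, (X ≅ Y) → P X → P Y) (X : A) : P X := by
  obtain ⟨Y, q, j, hY, hjq, hj, hq⟩ := exists_tower hG hPG hP hP' X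
  have := hG.hasCoproducts
  let c : Cofan fun n : ULift.{v} ℕ => Y n.down := Cofan.mk _ (Sigma.ι _)
  have hc : IsColimit c := coproductIsCoproduct _
  -- `H` is the telescope of the tower; the maps `q n` induce `p : H ⟶ X`, which the generators show
  -- to be invertible.
  obtain ⟨H, k, δ, hH⟩ := distinguished_cocone_triangle (oneSubShift j hc)
  have hk : oneSubShift j hc ≫ k = 0 := comp_distTriang_mor_zero₁₂ _ hH
  have hκ : ∀ n, j n ≫ c.inj ⟨n + 1⟩ ≫ k = c.inj ⟨n⟩ ≫ k := by
    intro n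
    have h := c.inj ⟨n⟩ ≫= hk
    rw [← Category.assoc, inj_oneSubShift, comp_zero, Preadditive.sub_comp, sub_eq_zero,
      Category.assoc] at h
    exact h.symm
  obtain ⟨p, hp⟩ : ∃ p : H ⟶ X, Cofan.IsColimit.desc hc (fun n => q n.down) = k ≫ p := by
    refine Triangle.yoneda_exact₂ _ hH _ (Cofan.IsColimit.hom_ext hc _ _ fun ⟨n⟩ => ?_)
    change c.inj ⟨n⟩ ≫ oneSubShift j hc ≫ _ = _
    rw [← Category.assoc, inj_oneSubShift, Preadditive.sub_comp, Category.assoc]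
    change _ = c.inj ⟨n⟩ ≫ (0 : c.pt ⟶ X)
    simp [hjq]
  have hp' : ∀ n, c.inj ⟨n⟩ ≫ k ≫ p = q n := by
    intro n
    rw [← hp]
    simp
  have : IsIso p := by
    refine hG.detects p fun t ht => ?_
    have htf := (hG.compact t ht).factorsFinitely
    constructor
    · refine (injective_iff_map_eq_zero (Preadditive.rightComp t p)).2 fun a ha => ?_
      change a ≫ p = 0 at ha
      -- `1 - shift` is injective on maps from the desuspension of `t`, so `a` has zero boundary and
      -- comes from the coproduct, hence from a single stage `Y N`. There `q N` kills it, and the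
      -- next stage of the tower does too.
      have hδ : a ≫ δ = 0 := by
        refine eq_zero_of_comp_shift
          (fun b hb => (htf.shift (-1)).eq_zero_of_comp_oneSubShift j hc b hb) _ ?_
        have : δ ≫ (oneSubShift j hc)⟦(1 : ℤ)⟧' = 0 := comp_distTriang_mor_zero₃₁ _ hH
        rw [Category.assoc, this, comp_zero]
      obtain ⟨b, rfl⟩ : ∃ b, a = b ≫ k := Triangle.coyoneda_exact₃ _ hH a hδ
      obtain ⟨F, x, rfl⟩ := htf _ _ c hc b
      obtain ⟨N, x', hx'⟩ := exists_factor_sum (κ := fun n => c.inj ⟨n⟩ ≫ k) hκ F x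
      have hb : (∑ i ∈ F, x i ≫ c.inj i) ≫ k = x' ≫ c.inj ⟨N⟩ ≫ k := by
        rw [hx', Preadditive.sum_comp]
        simp only [Category.assoc]
      rw [hb] at ha ⊢
      rw [Category.assoc, Category.assoc, hp'] at ha
      rw [← hκ, ← Category.assoc, hj N t ht x' ha, zero_comp]
    · intro f
      obtain ⟨f', rfl⟩ := hq t ht f
      exact ⟨f' ≫ c.inj ⟨0⟩ ≫ k, by simp [hp']⟩
  have hcP : P c.pt := hP _ _ c hc fun n => hY n.down
  exact hiso (asIso p) (hP' _ hH hcP hcP)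

end Localizing

/-! ### Compact objects as retracts -/

section Thick

open Pretriangulated

variable {A : Type u} [Category.{v} A] [Preadditive A] [HasZeroObject A] [HasShift A ℤ]
  [∀ n : ℤ, (shiftFunctor A n).Additive] [Pretriangulated A]

/-- Every map from a compact object to `M` vanishes on an object with the same class modulo `Q`. -/
def KilledBy (Q : ObjectProperty A) : ObjectProperty A := fun M =>
  ∀ X : A, FactorsFinitely X → ∀ f : X ⟶ M, ∃ (B : A) (s : B ⟶ X), Q.trW s ∧ s ≫ f = 0

variable {Q : ObjectProperty A}

/-- `B` is an extension of `X` by a desuspension of an object of `Q`. This keeps sources compact, so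
that killing can be iterated. -/
lemma factorsFinitely_of_trW (hQ : ∀ N, Q N → FactorsFinitely N) {B X : A} {s : B ⟶ X}
    (hs : Q.trW s) (hX : FactorsFinitely X) : FactorsFinitely B := by
  obtain ⟨N, g, h, hT, hN⟩ := hs
  exact FactorsFinitely.ext₂ (inv_rot_of_distTriang _ hT) ((hQ N hN).shift (-1)) hX

lemma killedBy_of_prop {M : A} (hM : Q M) : KilledBy Q M := by
  intro X _ f
  obtain ⟨B, s, δ, hT⟩ := distinguished_cocone_triangle₁ f
  exact ⟨B, s, ⟨_, _, _, hT, hM⟩, comp_distTriang_mor_zero₁₂ _ hT⟩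

lemma KilledBy.shift_one [Q.IsStableUnderShift ℤ] {M : A} (hM : KilledBy Q M) :
    KilledBy Q (M⟦(1 : ℤ)⟧) := by
  intro X hX f
  let e := shiftFunctorCompIsoId A (1 : ℤ) (-1) (by simp)
  let e' := shiftFunctorCompIsoId A (-1 : ℤ) 1 (by simp)
  obtain ⟨B, s, hs, hsf⟩ := hM _ (hX.shift (-1)) (f⟦(-1 : ℤ)⟧' ≫ e.hom.app M)
  refine ⟨_, s⟦(1 : ℤ)⟧' ≫ e'.hom.app X,
    (MorphismProperty.cancel_right_of_respectsIso _ _ _).2 (hs.shift 1), ?_⟩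
  have hn := e'.hom.naturality f
  dsimp at hn
  have hsf' : s ≫ f⟦(-1 : ℤ)⟧' = 0 := by
    rwa [← cancel_mono (e.hom.app M), zero_comp, Category.assoc]
  rw [Category.assoc, ← hn, ← Category.assoc, ← Functor.map_comp, hsf', Functor.map_zero,
    zero_comp]

/-- Killing the boundary of `f` first lets it lift to `T.obj₂`; the lift is then killed on a second
replacement of the source. -/
lemma KilledBy.cone [IsTriangulated A] [Q.IsTriangulated] (hQ : ∀ N, Q N → FactorsFinitely N)
    {T : Triangle A} (hT : T ∈ distTriang A) (h₁ : KilledBy Q T.obj₁)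
    (h₂ : KilledBy Q T.obj₂) : KilledBy Q T.obj₃ := by
  intro X hX f
  obtain ⟨B, s, hs, hsf⟩ := h₁.shift_one X hX (f ≫ T.mor₃)
  obtain ⟨g, hg⟩ := T.coyoneda_exact₃ hT (s ≫ f) (by rw [Category.assoc, hsf])
  obtain ⟨B', s', hs', hsg⟩ := h₂ B (factorsFinitely_of_trW hQ hs hX) g
  refine ⟨B', s' ≫ s, Q.trW.comp_mem _ _ hs' hs, ?_⟩
  rw [Category.assoc, hg, ← Category.assoc, hsg, zero_comp]

/-- A map from a compact object involves finitely many summands, which are killed one after another.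
-/
lemma KilledBy.coproduct [IsTriangulated A] [Q.IsTriangulated]
    (hQ : ∀ N, Q N → FactorsFinitely N) {I : Type v} {M : I → A} {c : Cofan M}
    (hc : IsColimit c) (hM : ∀ i, KilledBy Q (M i)) : KilledBy Q c.pt := by
  intro X hX f
  obtain ⟨F, x, rfl⟩ := hX I M c hc f
  classical
  induction F using Finset.induction_on with
  | empty => exact ⟨X, 𝟙 X, Q.trW.id_mem X, by simp⟩
  | insert i F hi ih =>
    obtain ⟨B, s, hs, hsF⟩ := ih
    obtain ⟨B', s', hs', hsx⟩ := hM i B (factorsFinitely_of_trW hQ hs hX) (s ≫ x i)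
    refine ⟨B', s' ≫ s, Q.trW.comp_mem _ _ hs' hs, ?_⟩
    rw [Finset.sum_insert hi, Preadditive.comp_add, Category.assoc, Category.assoc, hsF,
      comp_zero, add_zero, reassoc_of% hsx, zero_comp]

lemma KilledBy.of_iso {M N : A} (e : M ≅ N) (hM : KilledBy Q M) : KilledBy Q N := by
  intro X hX f
  obtain ⟨B, s, hs, hsf⟩ := hM X hX (f ≫ e.inv)
  exact ⟨B, s, hs, by rwa [← cancel_mono e.inv, zero_comp, Category.assoc]⟩

/-- Compact objects are retracts of objects of any triangulated subcategory of compact objects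
that contains the generators. -/
theorem IsCompactlyGeneratedBy.exists_retract [IsTriangulated A] [Q.IsTriangulated] {G : Set A}
    (hG : IsCompactlyGeneratedBy G) (hQ : ∀ N, Q N → FactorsFinitely N) (hGQ : ∀ X ∈ G, Q X)
    {X : A} (hX : FactorsFinitely X) : ∃ N, Q N ∧ Nonempty (Retract X N) := by
  have h : KilledBy Q X := hG.induction (fun M hM => killedBy_of_prop (hGQ M hM))
    (fun _ _ _ hc => KilledBy.coproduct hQ hc) (fun _ hT => KilledBy.cone hQ hT)
    KilledBy.of_iso X
  -- Killing the identity gives a zero map `s` with cone `N` in `Q`, so `X ⟶ N` is a split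
  -- monomorphism.
  obtain ⟨B, s, ⟨N, m, δ, hT, hN⟩, hs⟩ := h X hX (𝟙 X)
  obtain ⟨r, hr⟩ := Triangle.yoneda_exact₂ _ hT (𝟙 X) hs
  exact ⟨N, hN, ⟨⟨m, r, hr.symm⟩⟩⟩

end Thick

/-! ### Natural transformations between exact functors -/

section NatTrans

open Pretriangulated

variable {C : Type u₁} [Category.{v} C] {D : Type u₂} [Category.{v} D] {F F' : C ⥤ D}
  (α : F ⟶ F')

lemma isIso_app_of_retract {X N : C} (h : Retract X N) [IsIso (α.app N)] : IsIso (α.app X) := by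
  refine ⟨F'.map h.i ≫ inv (α.app N) ≫ F.map h.r, ?_, ?_⟩
  · rw [← α.naturality_assoc, IsIso.hom_inv_id_assoc, ← F.map_comp, h.retract, F.map_id]
  · rw [Category.assoc, Category.assoc, α.naturality, IsIso.inv_hom_id_assoc, ← F'.map_comp,
      h.retract, F'.map_id]

variable [Preadditive C] [HasZeroObject C] [HasShift C ℤ]
  [∀ n : ℤ, (shiftFunctor C n).Additive] [Pretriangulated C]
  [Preadditive D] [HasZeroObject D] [HasShift D ℤ]
  [∀ n : ℤ, (shiftFunctor D n).Additive] [Pretriangulated D]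

lemma exists_lift_of_comp_map_eq_zero (F : C ⥤ D) [F.CommShift ℤ] [F.IsTriangulated]
    {T : Triangle C} (hT : T ∈ distTriang C) {Y : D} (y : Y ⟶ F.obj T.obj₂)
    (hy : y ≫ F.map T.mor₂ = 0) : ∃ z : Y ⟶ F.obj T.obj₁, y = z ≫ F.map T.mor₁ :=
  Triangle.coyoneda_exact₂ _ (F.map_distinguished T hT) y hy

/-- The five lemma for a natural transformation, not assumed to commute with the shifts, between
triangulated functors. -/
lemma isIso_app_obj₃ [F.CommShift ℤ] [F.IsTriangulated] [F'.CommShift ℤ] [F'.IsTriangulated]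
    {T : Triangle C} (hT : T ∈ distTriang C) (h₁ : IsIso (α.app T.obj₁))
    (h₂ : IsIso (α.app T.obj₂)) (h₁' : IsIso (α.app (T.obj₁⟦(1 : ℤ)⟧)))
    (h₂' : IsIso (α.app (T.obj₂⟦(1 : ℤ)⟧))) : IsIso (α.app T.obj₃) := by
  have hT' := rot_of_distTriang _ hT
  have hT'' := rot_of_distTriang _ hT'
  refine isIso_of_yoneda_map_bijective _ fun Y => ⟨?_, fun y' => ?_⟩
  · refine (injective_iff_map_eq_zero (Preadditive.rightComp Y (α.app T.obj₃))).2 fun y hy => ?_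
    change y ≫ α.app T.obj₃ = 0 at hy
    obtain ⟨z, rfl⟩ : ∃ z, y = z ≫ F.map T.mor₂ := by
      refine exists_lift_of_comp_map_eq_zero F hT' y ?_
      change y ≫ F.map T.mor₃ = 0
      rw [← cancel_mono (α.app _), Category.assoc, α.naturality, ← Category.assoc, hy, zero_comp,
        zero_comp]
    obtain ⟨w, hw⟩ := exists_lift_of_comp_map_eq_zero F' hT (z ≫ α.app T.obj₂) (by
      rw [Category.assoc, ← α.naturality, ← Category.assoc, hy])
    have hz : z = (w ≫ inv (α.app T.obj₁)) ≫ F.map T.mor₁ := by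
      rw [← cancel_mono (α.app _), hw, Category.assoc, α.naturality, Category.assoc,
        IsIso.inv_hom_id_assoc]
    rw [hz, Category.assoc, ← F.map_comp, comp_distTriang_mor_zero₁₂ _ hT, F.map_zero, comp_zero]
  -- The boundary of `y'`, pulled back along `α`, dies in `F` of the shifted second vertex and so is
  -- the boundary of some `z`. The error `y' - z ≫ α` has no boundary and comes from the second
  -- vertex, where `α` is invertible.
  · obtain ⟨z, hz⟩ : ∃ z, (y' ≫ F'.map T.mor₃) ≫ inv (α.app _) = z ≫ F.map T.mor₃ := by
      refine exists_lift_of_comp_map_eq_zero F hT'' _ ?_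
      change _ ≫ F.map (-(T.mor₁⟦(1 : ℤ)⟧')) = 0
      rw [← cancel_mono (α.app _), zero_comp, Category.assoc, α.naturality, Category.assoc,
        IsIso.inv_hom_id_assoc, Category.assoc, ← F'.map_comp, Preadditive.comp_neg,
        comp_distTriang_mor_zero₃₁ _ hT, neg_zero, F'.map_zero, comp_zero]
    obtain ⟨u, hu⟩ : ∃ u, y' - z ≫ α.app _ = u ≫ F'.map T.mor₂ := by
      refine exists_lift_of_comp_map_eq_zero F' hT' _ ?_
      change _ ≫ F'.map T.mor₃ = 0
      rw [Preadditive.sub_comp, Category.assoc, ← α.naturality, ← Category.assoc, ← hz,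
        Category.assoc, IsIso.inv_hom_id, Category.comp_id, sub_self]
    refine ⟨z + (u ≫ inv (α.app T.obj₂)) ≫ F.map T.mor₂, ?_⟩
    change (z + (u ≫ inv (α.app T.obj₂)) ≫ F.map T.mor₂) ≫ α.app _ = y'
    rw [Preadditive.add_comp, Category.assoc, α.naturality, Category.assoc,
      IsIso.inv_hom_id_assoc, ← hu, add_sub_cancel]

end NatTrans

/-! ### Passage to coproducts -/

section Coproduct

variable {C : Type u₁} [Category.{v} C] [Preadditive C] {D : Type u₂} [Category.{v} D]
  [Preadditive D]

/-- A natural transformation from the right adjoint `R` of a functor that preserves compactness of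
generators to a coproduct preserving functor is invertible at a coproduct if it is so at the
summands. -/
lemma isIso_app_coproduct {L : D ⥤ C} {R F : C ⥤ D} (adj : L ⊣ R) [R.Additive] [F.Additive]
    (α : R ⟶ F) {H : Set D} (hH : IsCompactlyGeneratedBy H)
    (hL : ∀ Y ∈ H, FactorsFinitely (L.obj Y)) {I : Type v}
    [PreservesColimitsOfShape (Discrete I) F] {M : I → C} {c : Cofan M} (hc : IsColimit c)
    (hM : ∀ i, IsIso (α.app (M i))) : IsIso (α.app c.pt) := by
  refine hH.detects _ fun Y hY => ⟨?_, fun y' => ?_⟩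
  · refine (injective_iff_map_eq_zero (Preadditive.rightComp Y (α.app c.pt))).2 fun y hy => ?_
    change y ≫ α.app c.pt = 0 at hy
    have := adj.left_adjoint_additive
    rw [← (adj.homEquiv Y c.pt).symm.injective.eq_iff]
    have hzero : (adj.homEquiv Y c.pt).symm 0 = 0 := by simp [Adjunction.homEquiv_counit]
    rw [hzero]
    -- The adjoint of `y` has compact source, so it suffices to see its components vanish, and each
    -- `α.app (M i)` is a monomorphism.
    refine (hL Y hY).eq_zero hc fun i => ?_
    rw [← Adjunction.homEquiv_naturality_right_symm]
    have : y ≫ R.map (cofanProj hc i) = 0 := by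
      rw [← cancel_mono (α.app _), Category.assoc, α.naturality, ← Category.assoc, hy, zero_comp,
        zero_comp]
    rw [this]
    simp [Adjunction.homEquiv_counit]
  · obtain ⟨hc'⟩ := exists_isColimit_map F hc
    obtain ⟨S, x, hx⟩ := (hH.compact Y hY).factorsFinitely I _ _ hc' y'
    refine ⟨∑ i ∈ S, (x i ≫ inv (α.app (M i))) ≫ R.map (c.inj i), ?_⟩
    change (∑ i ∈ S, (x i ≫ inv (α.app (M i))) ≫ R.map (c.inj i)) ≫ α.app c.pt = y'
    rw [hx, Preadditive.sum_comp]
    refine Finset.sum_congr rfl fun i _ => ?_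
    simp

end Coproduct

/-! ### Detecting isomorphisms on an essential image -/

section Plain

variable {C : Type u₁} [Category.{v} C] {D : Type u₂} [Category.{v} D]

lemma isIso_of_bijective_of_essSurj {B : Type u} [Category.{v} B] (L : B ⥤ D) [L.EssSurj]
    {X Y : D} (p : X ⟶ Y)
    (h : ∀ W : B, Function.Bijective fun g : L.obj W ⟶ X => g ≫ p) : IsIso p := by
  refine isIso_of_yoneda_map_bijective _ fun V => ?_
  let e := L.objObjPreimageIso V
  refine ⟨fun a b hab => ?_, fun y => ?_⟩
  · rw [← cancel_epi e.hom]
    refine (h _).1 ?_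
    change (e.hom ≫ a) ≫ p = (e.hom ≫ b) ≫ p
    rw [Category.assoc, Category.assoc]
    exact e.hom ≫= hab
  · obtain ⟨x, hx⟩ := (h _).2 (e.hom ≫ y)
    refine ⟨e.inv ≫ x, ?_⟩
    change x ≫ p = _ at hx
    change (e.inv ≫ x) ≫ p = y
    rw [Category.assoc, hx, e.inv_hom_id_assoc]

end Plain

/-! ### The maps `π̄`, `τ`, `ω` and the projection map -/

section Monoidal

variable {C : Type u₁} [Category.{v} C] [MonoidalCategory C]
  {D : Type u₂} [Category.{v} D] [MonoidalCategory D]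
  {fs : D ⥤ C} [fs.Monoidal] {fr fl : C ⥤ D} (adjl : fl ⊣ fs) (adjr : fs ⊣ fr)

/-- A triangle identity cancels `σ` against `ζ` at `f^*Y`. Identities for `π̄` are checked on this
simpler adjoint. -/
lemma homEquiv_piBar (Y : D) (X : C) :
    adjl.homEquiv _ _ (piBar adjl Y X) =
      (fs.obj Y ◁ adjl.unit.app X) ≫ Functor.LaxMonoidal.μ fs Y (fl.obj X) := by
  rw [piBar, oplaxMap, adjl.homEquiv_naturality_right, Equiv.apply_symm_apply, Category.assoc,
    ← Functor.LaxMonoidal.μ_natural_left, MonoidalCategory.tensorHom_def'_assoc]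
  erw [← comp_whiskerRight_assoc, adjl.right_triangle_components, id_whiskerRight,
    Category.id_comp]
  rfl

lemma piBar_naturality_right (Y : D) {X X' : C} (g : X ⟶ X') :
    fl.map (fs.obj Y ◁ g) ≫ piBar adjl Y X' = piBar adjl Y X ≫ Y ◁ fl.map g := by
  apply (adjl.homEquiv _ _).injective
  rw [adjl.homEquiv_naturality_left, adjl.homEquiv_naturality_right, homEquiv_piBar,
    homEquiv_piBar, Category.assoc, ← Functor.LaxMonoidal.μ_natural_right,
    ← whiskerLeft_comp_assoc, ← whiskerLeft_comp_assoc]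
  exact congrArg (fun k => fs.obj Y ◁ k ≫ _) (adjl.unit.naturality g)

lemma piBar_naturality_left {Y Y' : D} (g : Y ⟶ Y') (X : C) :
    fl.map (fs.map g ▷ X) ≫ piBar adjl Y' X = piBar adjl Y X ≫ g ▷ fl.obj X := by
  apply (adjl.homEquiv _ _).injective
  rw [adjl.homEquiv_naturality_left, adjl.homEquiv_naturality_right, homEquiv_piBar,
    homEquiv_piBar, Category.assoc, ← Functor.LaxMonoidal.μ_natural_left]
  exact (whisker_exchange_assoc _ _ _).symm

lemma piBar_tensor (Y Z : D) (X : C) :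
    fl.map (Functor.LaxMonoidal.μ fs Y Z ▷ X) ≫ piBar adjl (Y ⊗ Z) X =
      fl.map (α_ _ _ _).hom ≫ piBar adjl Y (fs.obj Z ⊗ X) ≫ (Y ◁ piBar adjl Z X) ≫
        (α_ _ _ _).inv := by
  have h : fs.obj Y ◁ adjl.unit.app (fs.obj Z ⊗ X) ≫ fs.obj Y ◁ fs.map (piBar adjl Z X) =
      fs.obj Y ◁ fs.obj Z ◁ adjl.unit.app X ≫
        fs.obj Y ◁ Functor.LaxMonoidal.μ fs Z (fl.obj X) := by
    rw [← whiskerLeft_comp, ← whiskerLeft_comp, ← homEquiv_piBar, adjl.homEquiv_unit]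
  apply (adjl.homEquiv _ _).injective
  rw [adjl.homEquiv_naturality_left, adjl.homEquiv_naturality_left,
    adjl.homEquiv_naturality_right, homEquiv_piBar, homEquiv_piBar, fs.map_comp, Category.assoc,
    ← Functor.LaxMonoidal.μ_natural_right_assoc, reassoc_of% h,
    Functor.LaxMonoidal.associativity_inv, ← associator_naturality_right_assoc,
    Iso.hom_inv_id_assoc]
  exact (whisker_exchange_assoc _ _ _).symm

/-- The natural transformation `π̄ : f_!(f^* Y ⊗ -) ⟶ Y ⊗ f_!(-)`. -/
def piBarNatTrans (Y : D) : tensorLeft (fs.obj Y) ⋙ fl ⟶ fl ⋙ tensorLeft Y where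
  app X := piBar adjl Y X
  naturality _ _ g := piBar_naturality_right adjl Y g

/-- The projection map `Y ⊗ f_* X ⟶ f_*(f^* Y ⊗ X)`. -/
def projectionMap (Y : D) (X : C) : Y ⊗ fr.obj X ⟶ fr.obj (fs.obj Y ⊗ X) :=
  adjr.homEquiv _ _ (Functor.OplaxMonoidal.δ fs Y (fr.obj X) ≫ fs.obj Y ◁ adjr.counit.app X)

lemma map_projectionMap_counit (Y : D) (X : C) :
    fs.map (projectionMap adjr Y X) ≫ adjr.counit.app _ =
      Functor.OplaxMonoidal.δ fs Y (fr.obj X) ≫ fs.obj Y ◁ adjr.counit.app X := by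
  exact (adjr.homEquiv_counit _ _ _).symm.trans (Equiv.symm_apply_apply _ _)

lemma whiskerLeft_projectionMap (Y : D) (X : C) {W : D} (g : W ⟶ fr.obj X) :
    (Y ◁ g) ≫ projectionMap adjr Y X =
      adjr.homEquiv _ _
        (Functor.OplaxMonoidal.δ fs Y W ≫ fs.obj Y ◁ (adjr.homEquiv _ _).symm g) := by
  rw [projectionMap, ← adjr.homEquiv_naturality_left, adjr.homEquiv_counit, whiskerLeft_comp,
    Functor.OplaxMonoidal.δ_natural_right_assoc]

/-- Test on objects `Y ⊗ W`: cancelling `Y`, using the adjunction and tensoring with `f^*Y` are all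
bijections, and their composite is composition with the projection map. -/
lemma isIso_projectionMap (Y : D) [(tensorLeft Y).IsEquivalence]
    [(tensorLeft (fs.obj Y)).IsEquivalence] (X : C) : IsIso (projectionMap adjr Y X) := by
  refine isIso_of_bijective_of_essSurj (tensorLeft Y) _ fun W => ?_
  have h : (fun g : (tensorLeft Y).obj W ⟶ Y ⊗ fr.obj X => g ≫ projectionMap adjr Y X) ∘
      (fun g : W ⟶ fr.obj X => (tensorLeft Y).map g) =
      (adjr.homEquiv _ _) ∘ (fun f => Functor.OplaxMonoidal.δ fs Y W ≫ f) ∘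
        (fun f => (tensorLeft (fs.obj Y)).map f) ∘ (adjr.homEquiv _ _).symm :=
    funext fun g => whiskerLeft_projectionMap adjr Y X g
  rw [← Function.Bijective.of_comp_iff _
    (Functor.FullyFaithful.ofFullyFaithful (tensorLeft Y)).homEquiv.bijective]
  change Function.Bijective (_ ∘ (fun g : W ⟶ fr.obj X => (tensorLeft Y).map g))
  rw [h]
  refine (Equiv.bijective _).comp (Function.Bijective.comp ?_ (Function.Bijective.comp ?_
    (Equiv.bijective _)))
  · exact ⟨fun a b hab => (cancel_epi _).1 hab,
      fun f => ⟨Functor.LaxMonoidal.μ fs Y W ≫ f, by simp⟩⟩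
  · exact (Functor.FullyFaithful.ofFullyFaithful (tensorLeft (fs.obj Y))).homEquiv.bijective

section Omega

variable {K : C} (θ : fr.obj (𝟙_ C) ≅ fl.obj K) (h : ∀ Y : D, IsIso (piBar adjl Y K))

lemma tau_piBar (Y : D) :
    tau adjl adjr θ h Y ≫ piBar adjl Y K = (ρ_ Y).inv ≫ (Y ◁ tauUnit adjr θ) := by
  simp [tau]

lemma tau_naturality {Y Y' : D} (g : Y ⟶ Y') :
    g ≫ tau adjl adjr θ h Y' = tau adjl adjr θ h Y ≫ fl.map (fs.map g ▷ K) := by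
  have := h Y'
  rw [← cancel_mono (piBar adjl Y' K), Category.assoc, tau_piBar, Category.assoc,
    piBar_naturality_left, reassoc_of% tau_piBar adjl adjr θ h Y, whisker_exchange,
    rightUnitor_inv_naturality_assoc]

lemma tau_tensor (Y W : D) :
    tau adjl adjr θ h (Y ⊗ W) ≫ fl.map (Functor.OplaxMonoidal.δ fs Y W ▷ K) ≫
        fl.map (α_ _ _ _).hom ≫ piBar adjl Y (fs.obj W ⊗ K) =
      Y ◁ tau adjl adjr θ h W := by
  have := h W
  rw [← cancel_mono (Y ◁ piBar adjl W K), ← cancel_mono (α_ _ _ _).inv, Category.assoc,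
    Category.assoc, Category.assoc, Category.assoc, ← piBar_tensor, ← fl.map_comp_assoc,
    ← comp_whiskerRight, Functor.Monoidal.δ_μ, id_whiskerRight, fl.map_id, Category.id_comp,
    tau_piBar, ← whiskerLeft_comp, tau_piBar]
  simp

/-- The map `ω` as a natural transformation `f_* ⟶ f_!(- ⊗ K)`. -/
noncomputable def omegaNatTrans : fr ⟶ tensorRight K ⋙ fl where
  app X := omega adjl adjr θ h X
  naturality X X' g := by
    dsimp [omega]
    rw [reassoc_of% tau_naturality adjl adjr θ h, Category.assoc, ← fl.map_comp, ← fl.map_comp,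
      ← comp_whiskerRight, ← comp_whiskerRight, adjr.counit_naturality]

/-- This linearity of `ω` over the target category replaces compatibility with the shift. -/
lemma projectionMap_omega (Y : D) (X : C) :
    projectionMap adjr Y X ≫ omega adjl adjr θ h (fs.obj Y ⊗ X) ≫ fl.map (α_ _ _ _).hom ≫
      piBar adjl Y (X ⊗ K) = Y ◁ omega adjl adjr θ h X := by
  rw [omega, omega, Category.assoc, reassoc_of% tau_naturality adjl adjr θ h, whiskerLeft_comp,
    ← tau_tensor, Category.assoc, Category.assoc, Category.assoc, ← piBar_naturality_right,
    ← fl.map_comp_assoc (_ ▷ K), ← comp_whiskerRight, map_projectionMap_counit,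
    comp_whiskerRight, fl.map_comp_assoc, ← fl.map_comp_assoc _ (α_ _ _ _).hom,
    ← fl.map_comp_assoc (α_ _ _ _).hom, ← associator_naturality_middle]
  rfl

lemma isIso_omega_tensor_iff (hpi : ∀ (X : C) (Y : D), IsIso (piBar adjl Y X)) (Y : D)
    [(tensorLeft Y).IsEquivalence] [(tensorLeft (fs.obj Y)).IsEquivalence] (X : C) :
    IsIso (omega adjl adjr θ h (fs.obj Y ⊗ X)) ↔ IsIso (omega adjl adjr θ h X) := by
  have := isIso_projectionMap adjr Y X
  have := hpi (X ⊗ K) Y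
  have h₁ := projectionMap_omega adjl adjr θ h Y X
  constructor
  · intro _
    have : IsIso ((tensorLeft Y).map (omega adjl adjr θ h X)) := by
      change IsIso (Y ◁ _)
      rw [← h₁]
      infer_instance
    exact isIso_of_reflects_iso _ (tensorLeft Y)
  · intro _
    have : IsIso (projectionMap adjr Y X ≫ omega adjl adjr θ h (fs.obj Y ⊗ X) ≫
        fl.map (α_ _ _ _).hom ≫ piBar adjl Y (X ⊗ K)) := by
      rw [h₁]
      infer_instance
    have := IsIso.of_isIso_comp_left (projectionMap adjr Y X) (omega adjl adjr θ h
      (fs.obj Y ⊗ X) ≫ fl.map (α_ _ _ _).hom ≫ piBar adjl Y (X ⊗ K))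
    exact IsIso.of_isIso_comp_right (omega adjl adjr θ h (fs.obj Y ⊗ X))
      (fl.map (α_ _ _ _).hom ≫ piBar adjl Y (X ⊗ K))

end Omega

end Monoidal

/-! ### Extending `π̄` from generators to all objects -/

section ClosedDetection

variable {C : Type u₁} [Category.{v} C] {D : Type u₂} [Category.{v} D]

/-- A natural transformation between left adjoints that is invertible on a set of objects
detecting isomorphisms is invertible. -/
lemma isIso_app_of_detects {L L' : C ⥤ D} {R R' : D ⥤ C} (adj : L ⊣ R) (adj' : L' ⊣ R')
    (β : L ⟶ L') {G : Set C}
    (hG : ∀ ⦃Y Z : C⦄ (f : Y ⟶ Z),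
      (∀ X ∈ G, Function.Bijective fun g : X ⟶ Y => g ≫ f) → IsIso f)
    (hβ : ∀ X ∈ G, IsIso (β.app X)) : IsIso β := by
  let γ := conjugateEquiv adj' adj β
  have hγ : ∀ (X : C) (Z : D) (g : X ⟶ R'.obj Z),
      g ≫ γ.app Z = adj.homEquiv _ _ (β.app X ≫ (adj'.homEquiv _ _).symm g) := by
    intro X Z g
    rw [← Equiv.symm_apply_eq]
    rw [adj.homEquiv_naturality_left_symm, adj.homEquiv_counit, conjugateEquiv_counit,
      adj'.homEquiv_counit, β.naturality_assoc]
  have : IsIso γ := by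
    rw [NatTrans.isIso_iff_isIso_app]
    intro Z
    refine hG _ fun X hX => ?_
    have := hβ X hX
    have : (fun g : X ⟶ R'.obj Z => g ≫ γ.app Z) =
        adj.homEquiv _ _ ∘ (fun k => β.app X ≫ k) ∘ (adj'.homEquiv _ _).symm :=
      funext fun g => hγ X Z g
    rw [this]
    exact (Equiv.bijective _).comp (Function.Bijective.comp
      ⟨fun a b hab => (cancel_epi _).1 hab, fun f => ⟨inv (β.app X) ≫ f, by simp⟩⟩
      (Equiv.bijective _))
  exact conjugateEquiv_of_iso adj' adj β

variable [MonoidalCategory C] [MonoidalClosed C] [MonoidalCategory D] [MonoidalClosed D]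
  {fs : D ⥤ C} [fs.Monoidal] {fl : C ⥤ D} (adjl : fl ⊣ fs)

lemma isIso_piBar {G : Set C}
    (hG : ∀ ⦃Y Z : C⦄ (f : Y ⟶ Z),
      (∀ X ∈ G, Function.Bijective fun g : X ⟶ Y => g ≫ f) → IsIso f) (Y : D)
    (hpi : ∀ X ∈ G, IsIso (piBar adjl Y X)) (X : C) : IsIso (piBar adjl Y X) := by
  have := isIso_app_of_detects ((ihom.adjunction (fs.obj Y)).comp adjl)
    (adjl.comp (ihom.adjunction Y)) (piBarNatTrans adjl Y) hG hpi
  exact inferInstanceAs (IsIso ((piBarNatTrans adjl Y).app X))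

end ClosedDetection

/-! ### Dualizable objects are compact when the unit is -/

section Dualizable

variable {A : Type u} [Category.{v} A] [MonoidalCategory A] [MonoidalClosed A]

/-- The coevaluation `𝟙 ⟶ D X ⊗ X` of a dualizable object. -/
lemma IsDualizable.exists_coevaluation [SymmetricCategory A] {X : A} (hX : IsDualizable X) :
    ∃ η : 𝟙_ A ⟶ dual X ⊗ X,
      (X ◁ η) ≫ (α_ X (dual X) X).inv ≫ ((ihom.ev X).app (𝟙_ A) ▷ X) ≫ (λ_ X).hom =
        (ρ_ X).hom := by
  have : IsIso (nu X X) := hX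
  refine ⟨MonoidalClosed.curry (ρ_ X).hom ≫ inv (nu X X), ?_⟩
  rw [← MonoidalClosed.uncurry_curry
    ((α_ X (dual X) X).inv ≫ ((ihom.ev X).app (𝟙_ A) ▷ X) ≫ (λ_ X).hom),
    ← MonoidalClosed.uncurry_natural_left]
  change MonoidalClosed.uncurry ((_ ≫ inv (nu X X)) ≫ nu X X) = _
  rw [Category.assoc, IsIso.inv_hom_id, Category.comp_id, MonoidalClosed.uncurry_curry]

lemma IsDualizable.factorsFinitely [SymmetricCategory A] [Preadditive A]
    (hadd : ∀ W : A, (tensorLeft W).Additive)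
    (hS : FactorsFinitely (𝟙_ A)) {X : A} (hX : IsDualizable X) : FactorsFinitely X := by
  obtain ⟨η, hη⟩ := hX.exists_coevaluation
  intro I M c hc f
  have : PreservesColimitsOfShape (Discrete I) (tensorLeft (dual X)) :=
    (ihom.adjunction (dual X)).leftAdjoint_preservesColimits.{v, v}.preservesColimitsOfShape
  obtain ⟨hc'⟩ := exists_isColimit_map (tensorLeft (dual X)) hc
  -- `D X ⊗ -` preserves coproducts, so the adjoint `𝟙 ⟶ D X ⊗ c.pt` of `f` splits as a finite sum;
  -- evaluation then recovers `f`.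
  obtain ⟨F, x, hx⟩ := hS I _ _ hc' (η ≫ dual X ◁ f)
  have hev : ∀ {W W' : A} (g : W ⟶ W'), X ◁ dual X ◁ g ≫ (α_ X (dual X) W').inv ≫
      ((ihom.ev X).app (𝟙_ A) ▷ W') ≫ (λ_ W').hom =
      ((α_ X (dual X) W).inv ≫ ((ihom.ev X).app (𝟙_ A) ▷ W) ≫ (λ_ W).hom) ≫ g := by
    intro W W' g
    rw [associator_inv_naturality_right_assoc, Category.assoc, Category.assoc,
      ← leftUnitor_naturality]
    exact congrArg _ (whisker_exchange_assoc _ _ _)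
  have hf : f = (ρ_ X).inv ≫ X ◁ (η ≫ dual X ◁ f) ≫ (α_ X (dual X) c.pt).inv ≫
      ((ihom.ev X).app (𝟙_ A) ▷ c.pt) ≫ (λ_ c.pt).hom := by
    rw [whiskerLeft_comp, Category.assoc, hev, ← Category.assoc (X ◁ η), hη,
      Iso.inv_hom_id_assoc]
  refine ⟨F, fun i => (ρ_ X).inv ≫ X ◁ x i ≫ (α_ X (dual X) (M i)).inv ≫
      ((ihom.ev X).app (𝟙_ A) ▷ M i) ≫ (λ_ (M i)).hom, ?_⟩
  have hsum : X ◁ (∑ i ∈ F, x i ≫ dual X ◁ c.inj i) = ∑ i ∈ F, X ◁ (x i ≫ dual X ◁ c.inj i) :=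
    have := hadd X
    (tensorLeft X).map_sum _ _
  rw [hf, hx]
  change (ρ_ X).inv ≫ X ◁ (∑ i ∈ F, x i ≫ dual X ◁ c.inj i) ≫ _ = _
  rw [hsum, Preadditive.sum_comp, Preadditive.comp_sum]
  refine Finset.sum_congr rfl fun i _ => ?_
  rw [whiskerLeft_comp, Category.assoc, hev]
  simp only [Category.assoc]

end Dualizable

/-! ### Suspension as tensoring with an invertible object -/

section Shift

variable {A : Type u} [Category.{v} A] [Preadditive A] [HasZeroObject A] [HasShift A ℤ]
  [∀ n : ℤ, (shiftFunctor A n).Additive] [Pretriangulated A] [MonoidalCategory A]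
  [TensorTriangulated A]

lemma tensorRight_additive (W : A) : (tensorRight W).Additive :=
  let := TensorTriangulated.commShift W
  have := TensorTriangulated.isTriangulated W
  inferInstance

lemma tensorLeft_additive [BraidedCategory A] (W : A) : (tensorLeft W).Additive :=
  have := tensorRight_additive W
  Functor.additive_of_iso (BraidedCategory.tensorLeftIsoTensorRight W).symm

/-- Tensoring with `Σ𝟙` is the suspension. -/
def shiftUnitTensorIso : tensorLeft ((𝟙_ A)⟦(1 : ℤ)⟧) ≅ shiftFunctor A (1 : ℤ) :=
  NatIso.ofComponents (fun X => tensorShift (𝟙_ A) X ≪≫ (shiftFunctor A 1).mapIso (λ_ X))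
    fun {X Y} g => by
      have h := TensorTriangulated.natural g (𝟙_ A)
      dsimp [tensorShift] at h ⊢
      rw [reassoc_of% h, Category.assoc, ← Functor.map_comp, ← Functor.map_comp,
        leftUnitor_naturality]

instance isEquivalence_tensorLeft_shiftUnit :
    (tensorLeft ((𝟙_ A)⟦(1 : ℤ)⟧)).IsEquivalence :=
  Functor.isEquivalence_of_iso shiftUnitTensorIso.symm

variable {D : Type u₂} [Category.{v} D] [HasShift D ℤ] [MonoidalCategory D]
  (fs : D ⥤ A) [fs.Monoidal] [fs.CommShift ℤ]

/-- `f^*(Σ𝟙) ≅ Σ𝟙`. -/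
def mapShiftUnitIso : fs.obj ((𝟙_ D)⟦(1 : ℤ)⟧) ≅ (𝟙_ A)⟦(1 : ℤ)⟧ :=
  (fs.commShiftIso (1 : ℤ)).app (𝟙_ D) ≪≫
    (shiftFunctor A (1 : ℤ)).mapIso (Functor.Monoidal.εIso fs).symm

/-- Tensoring with `f^*(Σ𝟙)` is the suspension. -/
def mapShiftUnitTensorIso :
    tensorLeft (fs.obj ((𝟙_ D)⟦(1 : ℤ)⟧)) ≅ shiftFunctor A (1 : ℤ) :=
  (curriedTensor A).mapIso (mapShiftUnitIso fs) ≪≫ shiftUnitTensorIso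

instance isEquivalence_tensorLeft_map_shiftUnit :
    (tensorLeft (fs.obj ((𝟙_ D)⟦(1 : ℤ)⟧))).IsEquivalence :=
  Functor.isEquivalence_of_iso (mapShiftUnitTensorIso fs).symm

end Shift

section ShiftInvariance

variable {A : Type u} [Category.{v} A] [HasShift A ℤ]

lemma prop_shift_of_iff {P : ObjectProperty A} [P.IsClosedUnderIsomorphisms]
    (h : ∀ X, P (X⟦(1 : ℤ)⟧) ↔ P X) (n : ℤ) (X : A) : P (X⟦n⟧) ↔ P X := by
  induction n using Int.induction_on with
  | zero => exact P.prop_iff_of_iso ((shiftFunctorZero A ℤ).app X)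
  | succ n ih =>
    rw [P.prop_iff_of_iso ((shiftFunctorAdd A (n : ℤ) 1).app X)]
    exact (h _).trans ih
  | pred n ih =>
    rw [← h]
    refine (P.prop_iff_of_iso ((shiftFunctorAdd' A (-(n : ℤ) - 1) 1 (-n) (by ring)).app X)).symm.trans ih

end ShiftInvariance

/-! ### The triangulated subcategory where `ω` is invertible -/

section Main

open Pretriangulated ZeroObject

variable {C : Type u₁} [Category.{v} C] [Preadditive C] [HasZeroObject C] [HasShift C ℤ]
  [∀ n : ℤ, (shiftFunctor C n).Additive] [Pretriangulated C]
  [MonoidalCategory C] [TensorTriangulated C]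
  {D : Type u₂} [Category.{v} D] [Preadditive D] [HasZeroObject D] [HasShift D ℤ]
  [∀ n : ℤ, (shiftFunctor D n).Additive] [Pretriangulated D]
  [MonoidalCategory D] [TensorTriangulated D]
  {fs : D ⥤ C} [fs.Monoidal] {fr fl : C ⥤ D} (adjl : fl ⊣ fs) (adjr : fs ⊣ fr)
  {K : C} (θ : fr.obj (𝟙_ C) ≅ fl.obj K) (hpi : ∀ (X : C) (Y : D), IsIso (piBar adjl Y X))

/-- The objects at which `ω` is invertible. -/
def OmegaIso : ObjectProperty C := fun X => IsIso (omega adjl adjr θ (hpi K) X)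

instance : (OmegaIso adjl adjr θ hpi).IsClosedUnderIsomorphisms where
  of_iso e h := (NatTrans.isIso_app_iff_of_iso (omegaNatTrans adjl adjr θ (hpi K)) e).1 h

variable [fs.CommShift ℤ]

/-- Invertibility of `ω` is invariant under suspension, since `ω` at `f^*(ΣT) ⊗ X ≅ ΣX` is
identified with `ΣT ⊗ ω` by the projection maps. -/
lemma omegaIso_shift_iff (n : ℤ) (X : C) :
    OmegaIso adjl adjr θ hpi (X⟦n⟧) ↔ OmegaIso adjl adjr θ hpi X := by
  refine prop_shift_of_iff (fun X => ?_) n X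
  refine ((OmegaIso adjl adjr θ hpi).prop_iff_of_iso
    ((mapShiftUnitTensorIso fs).app X)).symm.trans ?_
  exact isIso_omega_tensor_iff adjl adjr θ (hpi K) hpi _ X

/-- `f_*` and `f_!` are exact as adjoints of the exact functor `f^*`, so the five lemma applies to
`ω`. -/
lemma omegaIso_obj₃ [fs.IsTriangulated] {T : Triangle C} (hT : T ∈ distTriang C)
    (h₁ : OmegaIso adjl adjr θ hpi T.obj₁) (h₂ : OmegaIso adjl adjr θ hpi T.obj₂) :
    OmegaIso adjl adjr θ hpi T.obj₃ := by
  let := adjr.rightAdjointCommShift ℤ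
  have := adjr.commShift_of_leftAdjoint ℤ
  have := adjr.isTriangulated_rightAdjoint
  let := adjl.leftAdjointCommShift ℤ
  have := adjl.commShift_of_rightAdjoint ℤ
  have := adjl.isTriangulated_leftAdjoint
  let := TensorTriangulated.commShift K
  have := TensorTriangulated.isTriangulated K
  exact isIso_app_obj₃ (omegaNatTrans adjl adjr θ (hpi K)) hT h₁ h₂
    ((omegaIso_shift_iff adjl adjr θ hpi 1 _).2 h₁) ((omegaIso_shift_iff adjl adjr θ hpi 1 _).2 h₂)

/-- The compact objects at which `ω` is invertible. -/
def CompactOmegaIso : ObjectProperty C :=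
  fun X => FactorsFinitely X ∧ OmegaIso adjl adjr θ hpi X

instance [fs.IsTriangulated] : (CompactOmegaIso adjl adjr θ hpi).IsTriangulated where
  exists_zero := by
    have hF : ∀ (F : C ⥤ D) [F.Additive], IsZero (F.obj (0 : C)) :=
      fun F _ => F.map_isZero (isZero_zero C)
    have := adjr.right_adjoint_additive
    have := adjl.left_adjoint_additive
    have := tensorRight_additive K
    refine ⟨0, isZero_zero C, fun _ _ _ _ f => ⟨∅, fun _ => 0, (isZero_zero C).eq_of_src _ _⟩,
      ⟨0, (hF fr).eq_of_src _ _, (hF (tensorRight K ⋙ fl)).eq_of_src _ _⟩⟩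
  isStableUnderShiftBy n := ⟨fun X hX =>
    ⟨hX.1.shift n, (omegaIso_shift_iff adjl adjr θ hpi n X).2 hX.2⟩⟩
  ext₂' := by
    intro T hT h₁ h₃
    refine ObjectProperty.le_isoClosure _ _ ⟨FactorsFinitely.ext₂ hT h₁.1 h₃.1, ?_⟩
    -- After inverse rotation, the middle vertex becomes the third one.
    exact omegaIso_obj₃ adjl adjr θ hpi (inv_rot_of_distTriang _ hT)
      ((omegaIso_shift_iff adjl adjr θ hpi (-1) _).2 h₃.2) h₁.2

end Main

end Wirthmuller

theorem mainTheorem1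
    {C : Type u₁} [Category.{v} C] [Preadditive C] [HasZeroObject C] [HasShift C ℤ]
    [∀ n : ℤ, (shiftFunctor C n).Additive] [Pretriangulated C] [IsTriangulated C]
    [MonoidalCategory C] [SymmetricCategory C] [MonoidalClosed C]
    [Wirthmuller.TensorTriangulated C]
    {D : Type u₂} [Category.{v} D] [Preadditive D] [HasZeroObject D] [HasShift D ℤ]
    [∀ n : ℤ, (shiftFunctor D n).Additive] [Pretriangulated D] [IsTriangulated D]
    [MonoidalCategory D] [SymmetricCategory D] [MonoidalClosed D]
    [Wirthmuller.TensorTriangulated D]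
    (fs : D ⥤ C) [fs.Braided] [fs.CommShift ℤ] [fs.IsTriangulated]
    (hfs : Wirthmuller.ShiftMonoidalCompatible fs)
    (fr fl : C ⥤ D) (adjr : fs ⊣ fr) (adjl : fl ⊣ fs)
    (G : Set C) (hG : Wirthmuller.IsCompactlyGeneratedBy G)
    (hS : Wirthmuller.IsCompactObject (𝟙_ C))
    (hpi : ∀ X ∈ G, ∀ Y : D, IsIso (Wirthmuller.piBar adjl Y X)) :
    ∃ h : ∀ (X : C) (Y : D), IsIso (Wirthmuller.piBar adjl Y X),
      ∀ (K : C) (θ : fr.obj (𝟙_ C) ≅ fl.obj K),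
        (∀ X ∈ G, IsIso (Wirthmuller.omega adjl adjr θ (h K) X)) →
          ((∀ X ∈ G, Wirthmuller.IsDualizable X) →
            ∀ X : C, Wirthmuller.IsDualizable X →
              IsIso (Wirthmuller.omega adjl adjr θ (h K) X)) ∧
          ((∃ H : Set D, Wirthmuller.IsCompactlyGeneratedBy H ∧
              ∀ Y ∈ H, Wirthmuller.IsCompactObject (fs.obj Y)) →
            ∀ X : C, IsIso (Wirthmuller.omega adjl adjr θ (h K) X)) := by
  have h : ∀ (X : C) (Y : D), IsIso (Wirthmuller.piBar adjl Y X) := fun X Y =>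
    Wirthmuller.isIso_piBar adjl hG.detects Y (fun X hX => hpi X hX Y) X
  refine ⟨h, fun K θ hω => ⟨fun _ X hX => ?_, ?_⟩⟩
  · obtain ⟨N, hN, ⟨r⟩⟩ := hG.exists_retract (Q := Wirthmuller.CompactOmegaIso adjl adjr θ h)
      (fun _ hN => hN.1) (fun X hX => ⟨(hG.compact X hX).factorsFinitely, hω X hX⟩)
      (hX.factorsFinitely Wirthmuller.tensorLeft_additive hS.factorsFinitely)
    have : IsIso ((Wirthmuller.omegaNatTrans adjl adjr θ (h K)).app N) := hN.2
    exact Wirthmuller.isIso_app_of_retract (Wirthmuller.omegaNatTrans adjl adjr θ (h K)) r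
  · rintro ⟨H, hH, hHfs⟩
    have := adjr.right_adjoint_additive
    have := adjl.left_adjoint_additive
    have := Wirthmuller.tensorRight_additive K
    refine hG.induction (P := Wirthmuller.OmegaIso adjl adjr θ h) hω (fun I M c hc hM => ?_)
      (fun T hT => Wirthmuller.omegaIso_obj₃ adjl adjr θ h hT)
      (fun e => (Wirthmuller.OmegaIso adjl adjr θ h).prop_of_iso e)
    have : PreservesColimitsOfShape (Discrete I) (tensorLeft K) :=
      (ihom.adjunction K).leftAdjoint_preservesColimits.{v, v}.preservesColimitsOfShape
    have : PreservesColimitsOfShape (Discrete I) (tensorRight K) :=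
      preservesColimitsOfShape_of_natIso (BraidedCategory.tensorLeftIsoTensorRight K)
    have : PreservesColimitsOfShape (Discrete I) fl :=
      adjl.leftAdjoint_preservesColimits.{v, v}.preservesColimitsOfShape
    exact Wirthmuller.isIso_app_coproduct adjr (Wirthmuller.omegaNatTrans adjl adjr θ (h K)) hH
      (fun Y hY => (hHfs Y hY).factorsFinitely) hc hM
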